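/- Let $n\ge 1$ and let $(K_1,d_{K_1}),\dots,(K_n,d_{K_n})$ be nonempty, complete, separable metric spaces of diameter at most one. For each $i$ fix a point $\ast_i\in K_i$ and a Borel probability measure $\lambda_i$ on $K_i$, and let $\lambda=\lambda_1\times\cdots\times\lambda_n$. Equip $\prod_i K_i$ with the metric $$d_n(\mathbf x,\mathbf y)=\frac1n\sum_{i=1}^n d_{K_i}(x_i,y_i).$$ Let $f:\prod_i K_i\to\mathbb R$ be bounded and continuous. For $\mathbf x\in\prod_iK_i$, its discrete gradient at $\mathbf x$ is the bounded continuous function $\nabla f(\mathbf x,\cdot)$ on $\prod_i K_i$ given by $$\nabla f(\mathbf x,\mathbf y)=\sum_{i=1}^n\big[f(x_1,\dots,x_{i-1},y_i,x_{i+1},\dots,x_n)-f(x_1,\dots,x_{i-1},\ast_i,x_{i+1},\dots,x_n)\big].$$ For a set $A$ of bounded continuous functions and a real number $r$, let $\mathrm{cov}_r(A,\|\cdot\|)$ be the smallest cardinality of a covering of $A$ by sets whose diameter in the uniform norm $\|\cdot\|$ is less than $r$ (and $+\infty$ if there is no finite covering of this kind). **Proposition.** Let $\varepsilon,\delta\in\mathbb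 R$ and $L\ge 0$. Suppose that $f$ is $L$-Lipschitz for $d_n$, i.e. $|f(\mathbf x)-f(\mathbf y)|\le L\,d_n(\mathbf x,\mathbf y)$ for all $\mathbf x,\mathbf y$, and that $$\mathrm{cov}_{\delta n}\Big(\Big\{\nabla f(\mathbf x,\cdot):\ \mathbf x\in\prod_iK_i\Big\},\|\cdot\|\Big)\le e^{\varepsilon n}.$$ Then $$\log\int e^f\,d\lambda\ \le\ \sup_{\xi}\Big[\int f\,d\xi-\mathrm D(\xi\,\|\,\lambda)\Big]+(\varepsilon+\delta)n+\sqrt{\frac{\varepsilon+\delta}{2}}\;L,$$ where the supremum runs over all product measures $\xi=\xi_1\times\cdots\times\xi_n$ with $\xi_i$ a Borel probability measure on $K_i$, and $\mathrm D(\xi\,\|\,\lambda)\in[0,+\infty]$ is the Kullback--Leibler divergence (the bracket is $-\infty$ when it is infinite). -/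

import Mathlib

open MeasureTheory
open scoped BoundedContinuousFunction

noncomputable section

namespace NonlinearLD

/-- The normalized Hamming average `d_n(x, y) = (1/n) ∑ᵢ d_{Kᵢ}(xᵢ, yᵢ)` of the metrics on the
factors. -/
def avgDist {n : ℕ} {K : Fin n → Type*} [∀ i, MetricSpace (K i)] (x y : ∀ i, K i) : ℝ :=
  (1 / (n : ℝ)) * ∑ i, dist (x i) (y i)

/-- The discrete partial derivative `∂ᵢf(x, ·)` of `f` at `x`, relative to the reference point
`star`: the bounded continuous function on `Kᵢ` that sends `y` to
`f(x₁,…,xᵢ₋₁,y,xᵢ₊₁,…,xₙ) - f(x₁,…,xᵢ₋₁,starᵢ,xᵢ₊₁,…,xₙ)`. -/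
def partialDiff {n : ℕ} {K : Fin n → Type*} [∀ i, MetricSpace (K i)]
    (star : ∀ i, K i) (f : (∀ i, K i) →ᵇ ℝ) (x : ∀ i, K i) (i : Fin n) : K i →ᵇ ℝ :=
  f.compContinuous ⟨fun y => Function.update x i y, continuous_const.update i continuous_id⟩
    - BoundedContinuousFunction.const (K i) (f (Function.update x i (star i)))

/-- The discrete gradient `∇f(x, ·)` of `f` at `x`: the bounded continuous, additively separable
function `y ↦ ∑ᵢ ∂ᵢf(x, yᵢ)` on the product space. -/
def discreteGradient {n : ℕ} {K : Fin n → Type*} [∀ i, MetricSpace (K i)]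
    (star : ∀ i, K i) (f : (∀ i, K i) →ᵇ ℝ) (x : ∀ i, K i) : (∀ i, K i) →ᵇ ℝ :=
  ∑ i, (partialDiff star f x i).compContinuous ⟨fun y => y i, continuous_apply i⟩

/-- The covering number `cov_r(A)`: the smallest cardinality of a covering of `A` by sets of
diameter strictly less than `r` (it is `⊤` if there is no finite such covering). -/
def diamCoveringNumber {X : Type*} [PseudoMetricSpace X] (r : ℝ) (A : Set X) : ℕ∞ :=
  ⨅ (C : Set (Set X)) (_ : A ⊆ ⋃₀ C ∧ ∀ s ∈ C, Metric.ediam s < ENNReal.ofReal r), C.encard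

/-- The Gibbs functional `∫ f dξ - D(ξ ‖ lam)`, which is `-∞` when `D(ξ ‖ lam) = ∞`. -/
def gibbsFunctional {Ω : Type*} [MeasurableSpace Ω] (f : Ω → ℝ) (lam ξ : Measure Ω) : EReal :=
  ((∫ x, f x ∂ξ : ℝ) : EReal) - ((InformationTheory.klDiv ξ lam : ENNReal) : EReal)

end NonlinearLD

end

set_option linter.unusedSectionVars false

namespace NonlinearLD

/-! Write `P` for the product reference measure and `μ` for the Gibbs measure with density `e^f /
Z`. The covering of the gradients cuts the space into `N ≤ e^{εn}` pieces on which the gradient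
varies by at most `r = δn`. Let `ν_j` be `μ` conditioned on the `j`-th piece, `p_j` the `μ`-mass of
that piece, and `ξ_j` the product of the marginals of `ν_j`. The `ξ_j` are the competitors in the
supremum.

The total correlations `D(ν_j‖P) - D(ξ_j‖P)` have `p_j`-average at most `log N + r`. Indeed,
Donsker–Varadhan on each marginal, with the gradient nearly constant on the piece, bounds `D(ξ_j‖P)`
below by the `ν_j`-mean of the conditional entropy densities of `μ`, up to `r`
(`exists_product_of_gibbs_restrict`). Averaged over `j` these means add up to at least `D(μ‖P)` by
Han's inequality (`integral_gibbs_le_sum_coordAvg`), while the average of `D(ν_j‖P)` exceeds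
`D(μ‖P)` by the entropy of `(p_j)`, at most `log N`.

A small total correlation makes `∫ f dν_j` close to `∫ f dξ_j`: one tests the entropy against
`e^{tf}` and uses McDiarmid's bound, `f` having oscillation at most `L/n` in each coordinate
(`IsDensity.mul_integral_sub_le`). Summing over the pieces and optimizing in `t` gives
`log_integral_exp_le_of_partition`. -/

/-- A real function that is measurable and bounded. -/
structure IsBddMeas {Ω : Type*} [MeasurableSpace Ω] (g : Ω → ℝ) : Prop where
  measurable : Measurable g
  bdd : ∃ C, ∀ x, |g x| ≤ C

/-! ### Closure properties of bounded measurable functions. -/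

namespace IsBddMeas

variable {Ω : Type*} [MeasurableSpace Ω] {g h : Ω → ℝ}

theorem integrable (hg : IsBddMeas g) (P : Measure Ω) [IsFiniteMeasure P] : Integrable g P := by
  obtain ⟨C, hC⟩ := hg.bdd
  exact Integrable.of_bound hg.measurable.aestronglyMeasurable C (Filter.Eventually.of_forall hC)

theorem const (c : ℝ) : IsBddMeas (fun _ : Ω => c) := ⟨measurable_const, |c|, fun _ => le_rfl⟩

theorem add (hg : IsBddMeas g) (hh : IsBddMeas h) : IsBddMeas (fun x => g x + h x) := by
  obtain ⟨C, hC⟩ := hg.bdd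
  obtain ⟨D, hD⟩ := hh.bdd
  exact ⟨hg.measurable.add hh.measurable, C + D,
    fun x => (abs_add_le _ _).trans (add_le_add (hC x) (hD x))⟩

theorem mul (hg : IsBddMeas g) (hh : IsBddMeas h) : IsBddMeas (fun x => g x * h x) := by
  obtain ⟨C, hC⟩ := hg.bdd
  obtain ⟨D, hD⟩ := hh.bdd
  refine ⟨hg.measurable.mul hh.measurable, C * D, fun x => ?_⟩
  rw [abs_mul]
  exact mul_le_mul (hC x) (hD x) (abs_nonneg _) ((abs_nonneg _).trans (hC x))

theorem neg (hg : IsBddMeas g) : IsBddMeas (fun x => -g x) := by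
  obtain ⟨C, hC⟩ := hg.bdd
  exact ⟨hg.measurable.neg, C, fun x => by rw [abs_neg]; exact hC x⟩

theorem sub (hg : IsBddMeas g) (hh : IsBddMeas h) : IsBddMeas (fun x => g x - h x) := by
  simpa only [sub_eq_add_neg] using hg.add hh.neg

theorem sum {ι : Type*} (s : Finset ι) {G : ι → Ω → ℝ} (hG : ∀ i, IsBddMeas (G i)) :
    IsBddMeas (fun x => ∑ i ∈ s, G i x) := by
  classical
  induction s using Finset.induction_on with
  | empty => simpa using const 0
  | insert i s hi ih => simpa only [Finset.sum_insert hi] using (hG i).add ih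

theorem exp (hg : IsBddMeas g) : IsBddMeas (fun x => Real.exp (g x)) := by
  obtain ⟨C, hC⟩ := hg.bdd
  refine ⟨hg.measurable.exp, Real.exp C, fun x => ?_⟩
  rw [abs_of_pos (Real.exp_pos _)]
  exact Real.exp_le_exp.2 ((le_abs_self _).trans (hC x))

theorem log (hg : IsBddMeas g) {a : ℝ} (ha : 0 < a) (hga : ∀ x, a ≤ g x) :
    IsBddMeas (fun x => Real.log (g x)) := by
  obtain ⟨C, hC⟩ := hg.bdd
  refine ⟨hg.measurable.log, max |Real.log a| |Real.log C|, fun x => ?_⟩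
  exact abs_le_max_abs_abs (Real.log_le_log ha (hga x))
    (Real.log_le_log (ha.trans_le (hga x)) ((le_abs_self _).trans (hC x)))

theorem inv (hg : IsBddMeas g) {a : ℝ} (ha : 0 < a) (hga : ∀ x, a ≤ g x) :
    IsBddMeas (fun x => (g x)⁻¹) := by
  refine ⟨hg.measurable.inv, a⁻¹, fun x => ?_⟩
  rw [abs_of_nonneg (inv_nonneg.2 (ha.le.trans (hga x)))]
  exact inv_anti₀ ha (hga x)

theorem comp {Ω' : Type*} [MeasurableSpace Ω'] (hg : IsBddMeas g) {φ : Ω' → Ω}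
    (hφ : Measurable φ) : IsBddMeas (fun x => g (φ x)) := by
  obtain ⟨C, hC⟩ := hg.bdd
  exact ⟨hg.measurable.comp hφ, C, fun x => hC _⟩

theorem exp_lower (hg : IsBddMeas g) : ∃ a > 0, ∀ x, a ≤ Real.exp (g x) := by
  obtain ⟨C, hC⟩ := hg.bdd
  exact ⟨Real.exp (-C), Real.exp_pos _, fun x => Real.exp_le_exp.2 (neg_le_of_abs_le (hC x))⟩

end IsBddMeas

/-! ### Averaging over coordinates; Han's inequality. -/

section CoordAvg

variable {ι : Type*} [Fintype ι] [DecidableEq ι] {K : ι → Type*} [∀ i, MeasurableSpace (K i)]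
  (P : ∀ i, Measure (K i)) [∀ i, IsProbabilityMeasure (P i)]

/-- Averaging of a function on a product space over its `i`-th coordinate. -/
noncomputable def coordAvg (i : ι) (g : (∀ i, K i) → ℝ) (x : ∀ i, K i) : ℝ :=
  ∫ y, g (Function.update x i y) ∂(P i)

theorem measurable_update_prod (i : ι) :
    Measurable (fun p : (∀ i, K i) × K i => Function.update p.1 i p.2) := by
  refine measurable_pi_iff.2 fun j => ?_
  by_cases h : j = i
  · subst h
    simpa using measurable_snd
  · simp only [Function.update_of_ne h]
    fun_prop

/-- Resampling one coordinate independently leaves a product measure invariant; Fubini arguments for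
`coordAvg` and for marginals all pass through this. -/
theorem map_update_prod (i : ι) :
    ((Measure.pi P).prod (P i)).map (fun p => Function.update p.1 i p.2) = Measure.pi P := by
  symm
  refine Measure.pi_eq fun s hs => ?_
  rw [Measure.map_apply (measurable_update_prod i) (MeasurableSet.univ_pi hs)]
  have : (fun p : (∀ i, K i) × K i => Function.update p.1 i p.2) ⁻¹' (Set.univ.pi s)
      = (Set.univ.pi (Function.update s i Set.univ)) ×ˢ (s i) := by
    ext ⟨x, y⟩
    simp only [Set.mem_preimage, Set.mem_pi, Set.mem_univ, true_implies, Set.mem_prod]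
    constructor
    · intro h
      refine ⟨fun j => ?_, by simpa using h i⟩
      by_cases hj : j = i
      · subst hj; simp
      · simpa [Function.update_of_ne hj] using h j
    · rintro ⟨h, hy⟩ j
      by_cases hj : j = i
      · subst hj; simpa using hy
      · simpa [Function.update_of_ne hj] using h j
  rw [this, Measure.prod_prod, Measure.pi_pi, ← Finset.mul_prod_erase _ _ (Finset.mem_univ i),
    ← Finset.mul_prod_erase _ (fun j => P j (s j)) (Finset.mem_univ i)]
  simp only [Function.update_self, measure_univ, one_mul]
  rw [mul_comm]
  congr 1
  exact Finset.prod_congr rfl fun j hj => by rw [Function.update_of_ne (Finset.ne_of_mem_erase hj)]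

variable {P} {g h : (∀ i, K i) → ℝ}

theorem IsBddMeas.update (hg : IsBddMeas g) (i : ι) (x : ∀ i, K i) :
    IsBddMeas (fun y => g (Function.update x i y)) :=
  hg.comp (measurable_update x)

theorem IsBddMeas.coordAvg (hg : IsBddMeas g) (i : ι) : IsBddMeas (coordAvg P i g) := by
  obtain ⟨C, hC⟩ := hg.bdd
  refine ⟨?_, C, fun x => ?_⟩
  · have : StronglyMeasurable (fun p : (∀ i, K i) × K i => g (Function.update p.1 i p.2)) :=
      (hg.measurable.comp (measurable_update_prod i)).stronglyMeasurable
    exact (StronglyMeasurable.integral_prod_right (ν := P i) this).measurable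
  · have := norm_integral_le_of_norm_le_const (μ := P i) (f := fun y => g (Function.update x i y))
      (Filter.Eventually.of_forall fun y => hC _)
    simpa [NonlinearLD.coordAvg] using this

theorem integral_coordAvg (hg : IsBddMeas g) (i : ι) :
    ∫ x, coordAvg P i g x ∂(Measure.pi P) = ∫ x, g x ∂(Measure.pi P) := by
  conv_rhs => rw [← map_update_prod P i]
  rw [integral_map (measurable_update_prod i).aemeasurable hg.measurable.aestronglyMeasurable,
    integral_prod _ ((hg.comp (measurable_update_prod i)).integrable _)]
  rfl

theorem coordAvg_update (i : ι) (x : ∀ i, K i) (y : K i) :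
    coordAvg P i g (Function.update x i y) = coordAvg P i g x := by
  simp [coordAvg]

theorem coordAvg_mono (hg : IsBddMeas g) (hh : IsBddMeas h) (i : ι) {x : ∀ i, K i}
    (H : ∀ y, g (Function.update x i y) ≤ h (Function.update x i y)) :
    coordAvg P i g x ≤ coordAvg P i h x :=
  integral_mono ((hg.update i x).integrable _) ((hh.update i x).integrable _) H

theorem le_coordAvg (hg : IsBddMeas g) (i : ι) {a : ℝ} (H : ∀ x, a ≤ g x) (x : ∀ i, K i) :
    a ≤ coordAvg P i g x := by
  have := coordAvg_mono (P := P) (IsBddMeas.const a) hg i (x := x) fun y => H _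
  simpa [coordAvg] using this

/-- Successive averaging over the coordinates in a list. -/
noncomputable def listAvg (P : ∀ i, Measure (K i)) (l : List ι) (g : (∀ i, K i) → ℝ) :
    (∀ i, K i) → ℝ :=
  l.foldr (coordAvg P) g

theorem listAvg_cons (i : ι) (l : List ι) : listAvg P (i :: l) g = coordAvg P i (listAvg P l g) :=
  rfl

theorem IsBddMeas.listAvg (hg : IsBddMeas g) (l : List ι) : IsBddMeas (listAvg P l g) := by
  induction l with
  | nil => exact hg
  | cons i l ih => exact ih.coordAvg i

theorem le_listAvg (hg : IsBddMeas g) (l : List ι) {a : ℝ} (H : ∀ x, a ≤ g x) (x : ∀ i, K i) :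
    a ≤ listAvg P l g x := by
  induction l generalizing x with
  | nil => exact H x
  | cons i l ih => exact le_coordAvg (hg.listAvg l) i ih x

theorem integral_listAvg (hg : IsBddMeas g) (l : List ι) :
    ∫ x, listAvg P l g x ∂(Measure.pi P) = ∫ x, g x ∂(Measure.pi P) := by
  induction l with
  | nil => rfl
  | cons i l ih => rw [listAvg_cons, integral_coordAvg (hg.listAvg l), ih]

/-- Each average removes the dependence on its coordinate, so averaging over all of them leaves the
constant `∫ g`. -/
theorem listAvg_congr (l : List ι) {x x' : ∀ i, K i} (H : ∀ i, i ∉ l → x i = x' i) :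
    listAvg P l g x = listAvg P l g x' := by
  induction l generalizing x x' with
  | nil => rw [show x = x' from funext fun i => H i (by simp)]
  | cons i l ih =>
    refine integral_congr_ae (Filter.Eventually.of_forall fun y => ih fun j hj => ?_)
    by_cases hji : j = i
    · subst hji; simp
    · rw [Function.update_of_ne hji, Function.update_of_ne hji]
      exact H j (by simp [hji, hj])

theorem listAvg_univ (hg : IsBddMeas g) (x : ∀ i, K i) :
    listAvg P (Finset.univ : Finset ι).toList g x = ∫ x, g x ∂(Measure.pi P) := by
  rw [← integral_listAvg (P := P) hg (Finset.univ : Finset ι).toList]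
  have : ∀ x', listAvg P (Finset.univ : Finset ι).toList g x'
      = listAvg P (Finset.univ : Finset ι).toList g x := fun x' =>
    listAvg_congr _ fun i hi => absurd (by simp) hi
  simp [this]

/-- The decrement of the logarithm of a positive function under averaging over a coordinate is,
on average for the Gibbs weight `exp g`, at most the one for `exp g` itself. -/
theorem integral_log_sub_log_coordAvg_le (hg : IsBddMeas g) (hh : IsBddMeas h) {a : ℝ}
    (ha : 0 < a) (hah : ∀ x, a ≤ h x) (i : ι) :
    ∫ x, (Real.log (h x) - Real.log (coordAvg P i h x)) * Real.exp (g x) ∂(Measure.pi P)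
      ≤ ∫ x, (g x - Real.log (coordAvg P i (fun z => Real.exp (g z)) x)) * Real.exp (g x)
          ∂(Measure.pi P) := by
  obtain ⟨b, hb, hbg⟩ := hg.exp_lower
  have hE := le_coordAvg (P := P) hg.exp i hbg
  have hEh := le_coordAvg (P := P) hh i hah
  have mE : IsBddMeas (coordAvg P i (fun z => Real.exp (g z))) := hg.exp.coordAvg i
  have mEh : IsBddMeas (coordAvg P i h) := hh.coordAvg i
  set E := coordAvg P i (fun z => Real.exp (g z)) with hEdef
  set Eh := coordAvg P i h with hEhdef
  have mq0 : IsBddMeas (fun x => (Eh x)⁻¹ * E x) := (mEh.inv ha hEh).mul mE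
  have mq : IsBddMeas (fun x => h x * ((Eh x)⁻¹ * E x)) := hh.mul mq0
  -- `E` and `Eh` do not depend on coordinate `i`, so averaging `h * E / Eh` over it gives `E`, just
  -- as for `exp g`.
  have hq : ∫ x, h x * ((Eh x)⁻¹ * E x) ∂(Measure.pi P) = ∫ x, Real.exp (g x) ∂(Measure.pi P) := by
    rw [← integral_coordAvg mq i, ← integral_coordAvg hg.exp i]
    congr 1
    ext x
    have : coordAvg P i (fun x => h x * ((Eh x)⁻¹ * E x)) x = Eh x * ((Eh x)⁻¹ * E x) := by
      simp only [coordAvg, hEdef, hEhdef]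
      simp only [Function.update_idem, integral_mul_const]
    rw [this, mul_inv_cancel_left₀ (ha.trans_le (hEh x)).ne']
  -- This is `log s ≤ s - 1` at `s = h * E / (Eh * exp g)`, multiplied by `exp g`; the last bracket
  -- integrates to zero by `hq`.
  have key : ∀ x, (Real.log (h x) - Real.log (Eh x)) * Real.exp (g x)
      ≤ (g x - Real.log (E x)) * Real.exp (g x)
        + (h x * ((Eh x)⁻¹ * E x) - Real.exp (g x)) := by
    intro x
    have h1 := ha.trans_le (hah x)
    have h2 := ha.trans_le (hEh x)
    have h3 := hb.trans_le (hE x)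
    have h4 := Real.exp_pos (g x)
    have hlog := Real.log_le_sub_one_of_pos
      (show 0 < h x * ((Eh x)⁻¹ * E x) / Real.exp (g x) by positivity)
    rw [Real.log_div (by positivity) h4.ne', Real.log_mul h1.ne' (by positivity),
      Real.log_mul (by positivity) h3.ne', Real.log_inv, Real.log_exp] at hlog
    have := mul_le_mul_of_nonneg_right hlog h4.le
    rw [sub_mul (_ / _), div_mul_cancel₀ _ h4.ne'] at this
    linarith
  have m1 := ((hh.log ha hah).sub (mEh.log ha hEh)).mul hg.exp
  have m2 := (hg.sub (mE.log hb hE)).mul hg.exp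
  have m3 := mq.sub hg.exp
  calc _ ≤ ∫ x, ((g x - Real.log (E x)) * Real.exp (g x)
        + (h x * ((Eh x)⁻¹ * E x) - Real.exp (g x))) ∂(Measure.pi P) :=
        integral_mono (m1.integrable _) ((m2.add m3).integrable _) key
    _ = _ := by
        rw [integral_add (m2.integrable _) (m3.integrable _),
          integral_sub (mq.integrable _) (hg.exp.integrable _), hq, sub_self, add_zero]

/-- **Han's inequality** for the Gibbs measure with density proportional to `exp g`: its relative
entropy is at most the sum of its conditional relative entropies. -/
theorem integral_gibbs_le_sum_coordAvg (hg : IsBddMeas g) :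
    ∫ x, (g x - Real.log (∫ z, Real.exp (g z) ∂(Measure.pi P))) * Real.exp (g x) ∂(Measure.pi P)
      ≤ ∫ x, (∑ i, (g x - Real.log (coordAvg P i (fun z => Real.exp (g z)) x))) * Real.exp (g x)
          ∂(Measure.pi P) := by
  obtain ⟨b, hb, hbg⟩ := hg.exp_lower
  -- The entropy telescopes along successive averages of `exp g`, and each decrement is bounded by
  -- `integral_log_sub_log_coordAvg_le`.
  have main : ∀ l : List ι,
      ∫ x, (g x - Real.log (listAvg P l (fun z => Real.exp (g z)) x)) * Real.exp (g x)
          ∂(Measure.pi P)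
      ≤ (l.map fun i => ∫ x, (g x - Real.log (coordAvg P i (fun z => Real.exp (g z)) x))
          * Real.exp (g x) ∂(Measure.pi P)).sum := by
    intro l
    induction l with
    | nil => simp [listAvg]
    | cons i l ih =>
      have mh : IsBddMeas (listAvg P l fun z => Real.exp (g z)) := hg.exp.listAvg l
      have hl := le_listAvg (P := P) hg.exp l hbg
      have step := integral_log_sub_log_coordAvg_le (P := P) hg mh hb hl i
      have ml := mh.log hb hl
      have ml' := (mh.coordAvg (P := P) i).log hb (le_coordAvg mh i hl)
      rw [List.map_cons, List.sum_cons, add_comm]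
      refine le_trans (le_of_eq ?_) (add_le_add ih step)
      rw [← integral_add (((hg.sub ml).mul hg.exp).integrable _)
        (((ml.sub ml').mul hg.exp).integrable _)]
      congr 1
      ext x
      rw [listAvg_cons]
      ring
  have := main (Finset.univ : Finset ι).toList
  simp only [listAvg_univ hg.exp, Finset.sum_map_toList] at this
  refine this.trans (le_of_eq ?_)
  rw [← integral_finsetSum]
  · simp only [Finset.sum_mul]
  · intro i _
    exact ((hg.sub ((hg.exp.coordAvg i).log hb (le_coordAvg hg.exp i hbg))).mul hg.exp).integrable _

/-! ### Exponential moments under bounded oscillation. -/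

/-- **Hoeffding's lemma** for the exponential moment of a function of oscillation at most `c`. -/
theorem integral_exp_le_of_osc {Ω : Type*} [MeasurableSpace Ω] {Q : Measure Ω}
    [IsProbabilityMeasure Q] {X : Ω → ℝ} (hX : IsBddMeas X) {c : ℝ}
    (hc : ∀ y y', X y ≤ X y' + c) :
    ∫ y, Real.exp (X y) ∂Q ≤ Real.exp (∫ y, X y ∂Q + c ^ 2 / 8) := by
  obtain ⟨C, hC⟩ := hX.bdd
  have hne : Nonempty Ω := by
    by_contra hΩ
    rw [not_nonempty_iff] at hΩ
    have := measure_univ (μ := Q)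
    rw [Measure.eq_zero_of_isEmpty Q] at this
    simp at this
  have hbb : BddBelow (Set.range X) :=
    ⟨-C, by rintro _ ⟨y, rfl⟩; exact neg_le_of_abs_le (hC y)⟩
  have hmem : ∀ᵐ y ∂Q, X y ∈ Set.Icc (⨅ y, X y) ((⨅ y, X y) + c) :=
    Filter.Eventually.of_forall fun y =>
      ⟨ciInf_le hbb y, by
        have : X y - c ≤ ⨅ y, X y := le_ciInf fun y' => by linarith [hc y y']
        linarith⟩
  have := (ProbabilityTheory.hasSubgaussianMGF_of_mem_Icc hX.measurable.aemeasurable hmem).mgf_le 1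
  simp only [ProbabilityTheory.mgf, one_mul, add_sub_cancel_left, Real.exp_sub,
    integral_div] at this
  rw [div_le_iff₀ (Real.exp_pos _), ← Real.exp_add] at this
  refine this.trans (le_of_eq ?_)
  congr 1
  push_cast
  rw [div_pow, Real.norm_eq_abs, sq_abs]
  ring

/-- Keeps the oscillation bound alive under averaging, so that Hoeffding's lemma can be applied one
coordinate at a time. -/
theorem coordAvg_osc (hg : IsBddMeas g) {c : ℝ}
    (hc : ∀ (x : ∀ i, K i) i y y', g (Function.update x i y) ≤ g (Function.update x i y') + c)
    (j : ι) (x : ∀ i, K i) (i : ι) (y y' : K i) :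
    coordAvg P j g (Function.update x i y) ≤ coordAvg P j g (Function.update x i y') + c := by
  have hc0 : 0 ≤ c := by linarith [hc x i y y]
  by_cases hij : i = j
  · subst hij
    simp only [coordAvg_update]
    linarith
  · have : coordAvg P j g (Function.update x i y') + c
        = ∫ z, (g (Function.update (Function.update x i y') j z) + c) ∂(P j) := by
      rw [integral_add ((hg.update j _).integrable _) (integrable_const c)]
      simp [coordAvg]
    rw [this]
    refine integral_mono ((hg.update j _).integrable _)
      (((hg.update j _).add (IsBddMeas.const c)).integrable _) fun z => ?_
    simp only [Function.update_comm hij]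
    exact hc _ _ _ _

/-- **McDiarmid's bound** on the exponential moment of a function on a product probability space
whose oscillation in every coordinate is at most `c`. -/
theorem integral_exp_le_of_coord_osc (hg : IsBddMeas g) {c : ℝ}
    (hc : ∀ (x : ∀ i, K i) i y y', g (Function.update x i y) ≤ g (Function.update x i y') + c) :
    ∫ x, Real.exp (g x) ∂(Measure.pi P)
      ≤ Real.exp (∫ x, g x ∂(Measure.pi P) + Fintype.card ι * (c ^ 2 / 8)) := by
  have osc : ∀ l : List ι, ∀ (x : ∀ i, K i) i y y', listAvg P l g (Function.update x i y)
      ≤ listAvg P l g (Function.update x i y') + c := by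
    intro l
    induction l with
    | nil => exact hc
    | cons j l ih => exact coordAvg_osc (hg.listAvg l) ih j
  have main : ∀ (l : List ι) x, listAvg P l (fun z => Real.exp (g z)) x
      ≤ Real.exp (listAvg P l g x + l.length * (c ^ 2 / 8)) := by
    intro l
    induction l with
    | nil => intro x; simp [listAvg]
    | cons j l ih =>
      intro x
      have ml : IsBddMeas (listAvg P l g) := hg.listAvg l
      refine (coordAvg_mono (hg.exp.listAvg l) (ml.add (IsBddMeas.const _)).exp j
        fun y => ih _).trans ?_
      refine (integral_exp_le_of_osc (Q := P j)
        ((ml.update j x).add (IsBddMeas.const _)) (c := c) fun y y' => ?_).trans (le_of_eq ?_)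
      · linarith [osc l x j y y']
      · rw [integral_add ((ml.update j x).integrable _) (integrable_const _)]
        simp only [listAvg_cons, coordAvg, List.length_cons, Nat.cast_add, Nat.cast_one,
          integral_const, probReal_univ, one_smul]
        ring_nf
  have hne : Nonempty (∀ i, K i) := by
    by_contra hΩ
    rw [not_nonempty_iff] at hΩ
    have := measure_univ (μ := Measure.pi P)
    rw [Measure.eq_zero_of_isEmpty (Measure.pi P)] at this
    simp at this
  have := main (Finset.univ : Finset ι).toList (Classical.arbitrary _)
  rwa [listAvg_univ hg.exp, listAvg_univ hg, Finset.length_toList, Finset.card_univ] at this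

end CoordAvg

theorem IsBddMeas.prod {Ω ι : Type*} [MeasurableSpace Ω] (s : Finset ι) {G : ι → Ω → ℝ}
    (hG : ∀ i, IsBddMeas (G i)) : IsBddMeas (fun x => ∏ i ∈ s, G i x) := by
  classical
  induction s using Finset.induction_on with
  | empty => simpa using IsBddMeas.const 1
  | insert i s hi ih => simpa only [Finset.prod_insert hi] using (hG i).mul ih

/-! ### Bounded densities and relative entropy. -/

/-- The measure with real density `ρ` with respect to `P`. -/
noncomputable def densMeasure {Ω : Type*} [MeasurableSpace Ω] (P : Measure Ω) (ρ : Ω → ℝ) :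
    Measure Ω :=
  P.withDensity fun x => ENNReal.ofReal (ρ x)

/-- A bounded probability density with respect to `P`. -/
structure IsDensity {Ω : Type*} [MeasurableSpace Ω] (P : Measure Ω) (ρ : Ω → ℝ) : Prop where
  bddMeas : IsBddMeas ρ
  nonneg : ∀ x, 0 ≤ ρ x
  integral_eq : ∫ x, ρ x ∂P = 1

namespace IsDensity

variable {Ω : Type*} [MeasurableSpace Ω] {P : Measure Ω} [IsProbabilityMeasure P] {ρ : Ω → ℝ}

theorem isProbabilityMeasure (hρ : IsDensity P ρ) : IsProbabilityMeasure (densMeasure P ρ) := by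
  refine ⟨?_⟩
  rw [densMeasure, withDensity_apply _ MeasurableSet.univ, Measure.restrict_univ,
    ← ofReal_integral_eq_lintegral_ofReal (hρ.bddMeas.integrable P)
      (Filter.Eventually.of_forall hρ.nonneg), hρ.integral_eq, ENNReal.ofReal_one]

theorem integral_dens (hρ : IsDensity P ρ) (g : Ω → ℝ) :
    ∫ x, g x ∂(densMeasure P ρ) = ∫ x, ρ x * g x ∂P := by
  rw [densMeasure, integral_withDensity_eq_integral_toReal_smul
    hρ.bddMeas.measurable.ennreal_ofReal (Filter.Eventually.of_forall fun _ => ENNReal.ofReal_lt_top)]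
  simp [ENNReal.toReal_ofReal (hρ.nonneg _)]

theorem integrable_dens (hρ : IsDensity P ρ) (g : Ω → ℝ) (h : Integrable (fun x => ρ x * g x) P) :
    Integrable g (densMeasure P ρ) := by
  rw [densMeasure, integrable_withDensity_iff_integrable_smul'
    hρ.bddMeas.measurable.ennreal_ofReal (Filter.Eventually.of_forall fun _ => ENNReal.ofReal_lt_top)]
  simpa [ENNReal.toReal_ofReal (hρ.nonneg _)] using h

theorem ae_pos (hρ : IsDensity P ρ) : ∀ᵐ x ∂(densMeasure P ρ), 0 < ρ x := by
  rw [densMeasure, ae_withDensity_iff hρ.bddMeas.measurable.ennreal_ofReal]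
  exact Filter.Eventually.of_forall fun x hx => by
    simpa using hx

theorem integrable_log (hρ : IsDensity P ρ) :
    Integrable (fun x => Real.log (ρ x)) (densMeasure P ρ) := by
  refine hρ.integrable_dens _ (IsBddMeas.integrable ⟨?_, ?_⟩ P)
  · exact hρ.bddMeas.measurable.mul hρ.bddMeas.measurable.log
  · obtain ⟨C, hC⟩ := hρ.bddMeas.bdd
    -- `ρ` need not be bounded away from zero, but `s log s` is continuous, hence bounded on `[-C,
    -- C]`.
    obtain ⟨D, hD⟩ := (isCompact_Icc (a := -C) (b := C)).exists_bound_of_continuousOn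
      Real.continuous_mul_log.continuousOn
    exact ⟨D, fun x => hD _ (abs_le.1 (hC x))⟩

/-- **Gibbs' inequality** in terms of densities. -/
theorem integral_log_le (hρ : IsDensity P ρ) {q : Ω → ℝ} (hq : IsBddMeas q) (hq0 : ∀ x, 0 ≤ q x)
    (hq1 : ∫ x, q x ∂P ≤ 1) (hpos : ∀ᵐ x ∂(densMeasure P ρ), 0 < q x)
    (hlog : Integrable (fun x => Real.log (q x)) (densMeasure P ρ)) :
    ∫ x, Real.log (q x) ∂(densMeasure P ρ) ≤ ∫ x, Real.log (ρ x) ∂(densMeasure P ρ) := by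
  have := hρ.isProbabilityMeasure
  -- Only an inequality: where `ρ` vanishes, the left side is `0`.
  have hle : ∀ x, ρ x * (q x / ρ x) ≤ q x := fun x => by
    rcases (hρ.nonneg x).eq_or_lt with h | h
    · simp [← h, hq0 x]
    · rw [mul_div_cancel₀ _ h.ne']
  have hge : ∀ x, 0 ≤ ρ x * (q x / ρ x) := fun x =>
    mul_nonneg (hρ.nonneg x) (div_nonneg (hq0 x) (hρ.nonneg x))
  have hint' : Integrable (fun x => ρ x * (q x / ρ x)) P := by
    obtain ⟨C, hC⟩ := hq.bdd
    refine IsBddMeas.integrable ⟨hρ.bddMeas.measurable.mul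
      (hq.measurable.div hρ.bddMeas.measurable), C, fun x => ?_⟩ P
    refine (abs_of_nonneg (hge x)).trans_le ?_
    exact (hle x).trans ((le_abs_self _).trans (hC x))
  have hint := hρ.integrable_dens _ hint'
  have h1 : ∫ x, (Real.log (q x) - Real.log (ρ x)) ∂(densMeasure P ρ)
      ≤ ∫ x, (q x / ρ x - 1) ∂(densMeasure P ρ) := by
    refine integral_mono_ae (hlog.sub hρ.integrable_log) (hint.sub (integrable_const 1)) ?_
    filter_upwards [hpos, hρ.ae_pos] with x hx hx'
    rw [← Real.log_div hx.ne' hx'.ne']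
    exact Real.log_le_sub_one_of_pos (div_pos hx hx')
  have h2 : ∫ x, q x / ρ x ∂(densMeasure P ρ) ≤ 1 := by
    rw [hρ.integral_dens]
    exact (integral_mono hint' (hq.integrable P) hle).trans hq1
  rw [integral_sub hlog hρ.integrable_log, integral_sub hint (integrable_const 1)] at h1
  simp only [integral_const, probReal_univ, one_smul] at h1
  linarith

/-- The **Donsker–Varadhan inequality** for a bounded function. -/
theorem integral_sub_log_integral_exp_le (hρ : IsDensity P ρ) {u : Ω → ℝ} (hu : IsBddMeas u) :
    ∫ x, u x ∂(densMeasure P ρ) - Real.log (∫ x, Real.exp (u x) ∂P)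
      ≤ ∫ x, Real.log (ρ x) ∂(densMeasure P ρ) := by
  have := hρ.isProbabilityMeasure
  have hW : 0 < ∫ x, Real.exp (u x) ∂P := integral_exp_pos (hu.exp.integrable P)
  set W := ∫ x, Real.exp (u x) ∂P with hWdef
  have hlog : ∀ x, Real.log (Real.exp (u x) * W⁻¹) = u x - Real.log W := fun x => by
    rw [Real.log_mul (Real.exp_pos _).ne' (by positivity), Real.log_exp, Real.log_inv]; ring
  -- Gibbs' inequality against the normalized density `e^u / W`.
  have := hρ.integral_log_le (q := fun x => Real.exp (u x) * W⁻¹)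
    (hu.exp.mul (IsBddMeas.const _)) (fun x => by positivity)
    (by rw [integral_mul_const, ← hWdef, mul_inv_cancel₀ hW.ne'])
    (Filter.Eventually.of_forall fun x => by positivity)
    (by simpa only [hlog] using (hu.sub (IsBddMeas.const _)).integrable _)
  simp only [hlog] at this
  rw [integral_sub (hu.integrable _) (integrable_const _)] at this
  simpa using this

theorem klDiv_dens (hρ : IsDensity P ρ) :
    InformationTheory.klDiv (densMeasure P ρ) P ≠ ⊤ ∧
      (InformationTheory.klDiv (densMeasure P ρ) P).toReal
        = ∫ x, Real.log (ρ x) ∂(densMeasure P ρ) := by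
  have := hρ.isProbabilityMeasure
  have hac : densMeasure P ρ ≪ P := withDensity_absolutelyContinuous _ _
  have hllr : llr (densMeasure P ρ) P =ᵐ[densMeasure P ρ] fun x => Real.log (ρ x) := by
    have := hac.ae_le (Measure.rnDeriv_withDensity P hρ.bddMeas.measurable.ennreal_ofReal)
    filter_upwards [this] with x hx
    rw [llr, densMeasure, hx, ENNReal.toReal_ofReal (hρ.nonneg x)]
  refine ⟨InformationTheory.klDiv_ne_top hac ((integrable_congr hllr).2 hρ.integrable_log), ?_⟩
  rw [InformationTheory.toReal_klDiv_of_measure_eq hac (by simp), integral_congr_ae hllr]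

end IsDensity

/-! ### Marginals and products of densities. -/

section Product

variable {ι : Type*} [Fintype ι] [DecidableEq ι] {K : ι → Type*} [∀ i, MeasurableSpace (K i)]
  {P : ∀ i, Measure (K i)} [∀ i, IsProbabilityMeasure (P i)]

/-- The density of the `i`-th marginal of the measure with density `ρ`. -/
noncomputable def marginalDensity (P : ∀ i, Measure (K i)) (ρ : (∀ i, K i) → ℝ) (i : ι)
    (y : K i) : ℝ :=
  ∫ x, ρ (Function.update x i y) ∂(Measure.pi P)

theorem isBddMeas_marginalDensity {ρ : (∀ i, K i) → ℝ} (hρ : IsBddMeas ρ) (i : ι) :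
    IsBddMeas (marginalDensity P ρ i) := by
  obtain ⟨C, hC⟩ := hρ.bdd
  refine ⟨?_, C, fun y => ?_⟩
  · have : StronglyMeasurable (fun p : (∀ i, K i) × K i => ρ (Function.update p.1 i p.2)) :=
      (hρ.measurable.comp (measurable_update_prod i)).stronglyMeasurable
    exact (StronglyMeasurable.integral_prod_left (μ := Measure.pi P) this).measurable
  · have := norm_integral_le_of_norm_le_const (μ := Measure.pi P)
      (f := fun x => ρ (Function.update x i y)) (Filter.Eventually.of_forall fun y => hC _)
    simpa [marginalDensity] using this

theorem IsDensity.marginal {ρ : (∀ i, K i) → ℝ} (hρ : IsDensity (Measure.pi P) ρ) (i : ι) :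
    IsDensity (P i) (marginalDensity P ρ i) := by
  refine ⟨isBddMeas_marginalDensity hρ.bddMeas i, fun y => integral_nonneg fun x => hρ.nonneg _, ?_⟩
  have h := hρ.integral_eq
  rw [← map_update_prod P i, integral_map (measurable_update_prod i).aemeasurable
    hρ.bddMeas.measurable.aestronglyMeasurable,
    integral_prod_symm _ ((hρ.bddMeas.comp (measurable_update_prod i)).integrable _)] at h
  exact h

theorem IsDensity.map_eval {ρ : (∀ i, K i) → ℝ} (hρ : IsDensity (Measure.pi P) ρ) (i : ι) :
    (densMeasure (Measure.pi P) ρ).map (fun x => x i)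
      = densMeasure (P i) (marginalDensity P ρ i) := by
  refine Measure.ext fun s hs => ?_
  have hs' : MeasurableSet ((fun x : ∀ i, K i => x i) ⁻¹' s) := measurable_pi_apply i hs
  have hm : Measurable (((fun x : ∀ i, K i => x i) ⁻¹' s).indicator
      fun x => ENNReal.ofReal (ρ x)) := hρ.bddMeas.measurable.ennreal_ofReal.indicator hs'
  rw [Measure.map_apply (measurable_pi_apply i) hs, densMeasure, densMeasure,
    withDensity_apply _ hs', withDensity_apply _ hs, ← lintegral_indicator hs',
    ← lintegral_indicator hs]
  conv_lhs => rw [← map_update_prod P i]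
  rw [lintegral_map hm (measurable_update_prod i)]
  refine (lintegral_prod_symm' _ (hm.comp (measurable_update_prod i))).trans ?_
  refine lintegral_congr fun y => ?_
  by_cases hy : y ∈ s
  · have hint : Integrable (fun x => ρ (Function.update x i y)) (Measure.pi P) :=
      (hρ.bddMeas.comp measurable_update_left).integrable _
    rw [Set.indicator_of_mem hy, marginalDensity, ofReal_integral_eq_lintegral_ofReal hint
      (Filter.Eventually.of_forall fun x => hρ.nonneg _)]
    exact lintegral_congr fun x => by simp [Set.indicator, hy]
  · simp [Set.indicator, hy]

variable {m : ∀ i, K i → ℝ}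

theorem IsDensity.pi (hm : ∀ i, IsDensity (P i) (m i)) :
    IsDensity (Measure.pi P) (fun x => ∏ i, m i (x i)) := by
  refine ⟨IsBddMeas.prod _ fun i => (hm i).bddMeas.comp (measurable_pi_apply i),
    fun x => Finset.prod_nonneg fun i _ => (hm i).nonneg _, ?_⟩
  rw [integral_fintype_prod_eq_prod (𝕜 := ℝ)]
  exact Finset.prod_eq_one fun i _ => (hm i).integral_eq

theorem pi_densMeasure (hm : ∀ i, IsDensity (P i) (m i)) :
    Measure.pi (fun i => densMeasure (P i) (m i))
      = densMeasure (Measure.pi P) (fun x => ∏ i, m i (x i)) := by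
  have := fun i => (hm i).isProbabilityMeasure
  refine Measure.pi_eq fun s hs => ?_
  have hint : ∀ i, IsBddMeas ((s i).indicator (m i)) := fun i => by
    obtain ⟨C, hC⟩ := (hm i).bddMeas.bdd
    refine ⟨(hm i).bddMeas.measurable.indicator (hs i), C, fun x => ?_⟩
    by_cases hx : x ∈ s i
    · simpa [hx] using hC x
    · simpa [hx] using (abs_nonneg _).trans (hC x)
  have hnn : ∀ i x, 0 ≤ (s i).indicator (m i) x := fun i =>
    Set.indicator_nonneg fun x _ => (hm i).nonneg x
  have hfac : ∀ i, densMeasure (P i) (m i) (s i)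
      = ENNReal.ofReal (∫ y, (s i).indicator (m i) y ∂(P i)) := fun i => by
    rw [densMeasure, withDensity_apply _ (hs i), ← lintegral_indicator (hs i),
      ofReal_integral_eq_lintegral_ofReal ((hint i).integrable _)
        (Filter.Eventually.of_forall (hnn i))]
    refine lintegral_congr fun y => ?_
    by_cases hy : y ∈ s i <;> simp [hy]
  simp only [hfac]
  rw [← ENNReal.ofReal_prod_of_nonneg fun i _ => integral_nonneg (hnn i),
    ← integral_fintype_prod_eq_prod (𝕜 := ℝ), densMeasure,
    withDensity_apply _ (MeasurableSet.univ_pi hs),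
    ← lintegral_indicator (MeasurableSet.univ_pi hs),
    ofReal_integral_eq_lintegral_ofReal ((IsBddMeas.prod _ fun i =>
      (hint i).comp (measurable_pi_apply i)).integrable _)
      (Filter.Eventually.of_forall fun x => Finset.prod_nonneg fun i _ => hnn i _)]
  refine lintegral_congr fun x => ?_
  by_cases hx : x ∈ Set.univ.pi s
  · rw [Set.indicator_of_mem hx]
    congr 1
    refine Finset.prod_congr rfl fun i _ => ?_
    rw [Set.indicator_of_mem (hx i trivial)]
  · rw [Set.indicator_of_notMem hx]
    simp only [Set.mem_pi, Set.mem_univ, true_implies, not_forall] at hx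
    obtain ⟨i, hi⟩ := hx
    rw [Finset.prod_eq_zero (Finset.mem_univ i) (Set.indicator_of_notMem hi _)]
    simp

theorem klDiv_pi_densMeasure (hm : ∀ i, IsDensity (P i) (m i)) :
    InformationTheory.klDiv (Measure.pi fun i => densMeasure (P i) (m i)) (Measure.pi P) ≠ ⊤ ∧
      (InformationTheory.klDiv (Measure.pi fun i => densMeasure (P i) (m i))
        (Measure.pi P)).toReal = ∑ i, ∫ y, Real.log (m i y) ∂(densMeasure (P i) (m i)) := by
  have := fun i => (hm i).isProbabilityMeasure
  have hkl := (IsDensity.pi hm).klDiv_dens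
  rw [← pi_densMeasure hm] at hkl
  refine ⟨hkl.1, hkl.2.trans ?_⟩
  -- The logarithm of the product splits into a sum only where no factor vanishes.
  have hpos : ∀ i, ∀ᵐ x ∂(Measure.pi fun i => densMeasure (P i) (m i)), 0 < m i (x i) := fun i =>
    (measurePreserving_eval (fun i => densMeasure (P i) (m i)) i).quasiMeasurePreserving.ae
      (hm i).ae_pos
  have hint : ∀ i, Integrable (fun x : ∀ i, K i => Real.log (m i (x i)))
      (Measure.pi fun i => densMeasure (P i) (m i)) := fun i =>
    integrable_comp_eval (μ := fun i => densMeasure (P i) (m i)) (hm i).integrable_log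
  have hlog : (fun x : ∀ i, K i => Real.log (∏ i, m i (x i)))
      =ᵐ[Measure.pi fun i => densMeasure (P i) (m i)] fun x => ∑ i, Real.log (m i (x i)) := by
    filter_upwards [ae_all_iff.2 hpos] with x hx
    exact Real.log_prod fun i _ => (hx i).ne'
  rw [integral_congr_ae hlog, integral_finsetSum _ fun i _ => hint i]
  refine Finset.sum_congr rfl fun i _ => ?_
  exact integral_comp_eval (μ := fun i => densMeasure (P i) (m i))
    (hm i).integrable_log.aestronglyMeasurable

end Product

/-! ### The Gibbs measure conditioned on one piece. -/

section Gibbs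

variable {ι : Type*} [Fintype ι] [DecidableEq ι] {K : ι → Type*} [∀ i, MeasurableSpace (K i)]
  {P : ∀ i, Measure (K i)} [∀ i, IsProbabilityMeasure (P i)]

/-- The mean of a function under a measure with a bounded density on a product space exceeds its
mean under the product of the marginals by no more than the total correlation of the measure
allows. -/
theorem IsDensity.mul_integral_sub_le {ρ : (∀ i, K i) → ℝ} (hρ : IsDensity (Measure.pi P) ρ)
    {m : ∀ i, K i → ℝ} (hm : ∀ i, IsDensity (P i) (m i))
    (hmap : ∀ i, (densMeasure (Measure.pi P) ρ).map (fun x => x i) = densMeasure (P i) (m i))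
    {g : (∀ i, K i) → ℝ} (hg : IsBddMeas g) {c : ℝ}
    (hc : ∀ (x : ∀ i, K i) i y y', g (Function.update x i y) ≤ g (Function.update x i y') + c)
    {t : ℝ} (ht : 0 ≤ t) :
    t * (∫ x, g x ∂(densMeasure (Measure.pi P) ρ)
        - ∫ x, g x ∂(Measure.pi fun i => densMeasure (P i) (m i)))
      - Fintype.card ι * ((t * c) ^ 2 / 8)
    ≤ ∫ x, Real.log (ρ x) ∂(densMeasure (Measure.pi P) ρ)
      - ∑ i, ∫ y, Real.log (m i y)
          ∂(densMeasure (P i) (m i)) := by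
  have := hρ.isProbabilityMeasure
  have := fun i => (hm i).isProbabilityMeasure
  set ν := densMeasure (Measure.pi P) ρ with hν
  set ξ := Measure.pi fun i => densMeasure (P i) (m i) with hξ
  have htg : IsBddMeas (fun x => t * g x) := (IsBddMeas.const t).mul hg
  have hW : 0 < ∫ x, Real.exp (t * g x) ∂ξ := integral_exp_pos (htg.exp.integrable ξ)
  have hMc := integral_exp_le_of_coord_osc (P := fun i => densMeasure (P i) (m i)) htg (c := t * c)
    fun x i y y' => by rw [← mul_add]; exact mul_le_mul_of_nonneg_left (hc x i y y') ht
  rw [← hξ] at hMc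
  set W := ∫ x, Real.exp (t * g x) ∂ξ with hWdef
  have hlogW : Real.log W ≤ t * ∫ x, g x ∂ξ + Fintype.card ι * ((t * c) ^ 2 / 8) := by
    rw [← integral_const_mul]
    exact (Real.log_le_iff_le_exp hW).2 hMc
  have hMd := IsDensity.pi hm
  have mp : ∀ i, MeasurePreserving (fun x : ∀ i, K i => x i) ν (densMeasure (P i) (m i)) :=
    fun i => ⟨measurable_pi_apply i, hmap i⟩
  have hpos : ∀ᵐ x ∂ν, ∀ i, 0 < m i (x i) :=
    ae_all_iff.2 fun i => (mp i).quasiMeasurePreserving.ae (hm i).ae_pos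
  have hint : ∀ i, Integrable (fun x : ∀ i, K i => Real.log (m i (x i))) ν := fun i => by
    have h := (hm i).integrable_log
    rw [← (mp i).map_eq] at h
    exact h.comp_measurable (measurable_pi_apply i)
  have hval : ∀ i, ∫ x : ∀ i, K i, Real.log (m i (x i)) ∂ν
      = ∫ y, Real.log (m i y) ∂(densMeasure (P i) (m i)) := fun i => by
    rw [← (mp i).map_eq, integral_map (measurable_pi_apply i).aemeasurable
      (hm i).bddMeas.measurable.log.aestronglyMeasurable]
  -- The competitor in Gibbs' inequality is `ξ` tilted by `e^{tg}`. By `hval` the factors `log (m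
  -- i)` have the same mean under `ν` as under its marginals, and `hlogW` bounds the normalization.
  have hq : IsBddMeas (fun x : ∀ i, K i => (∏ i, m i (x i)) * (Real.exp (t * g x) * W⁻¹)) :=
    hMd.bddMeas.mul (htg.exp.mul (IsBddMeas.const _))
  have hlog : (fun x : ∀ i, K i => Real.log ((∏ i, m i (x i)) * (Real.exp (t * g x) * W⁻¹)))
      =ᵐ[ν] fun x => ∑ i, Real.log (m i (x i)) + (t * g x - Real.log W) := by
    filter_upwards [hpos] with x hx
    rw [Real.log_mul (Finset.prod_pos fun i _ => hx i).ne' (by positivity),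
      Real.log_prod fun i _ => (hx i).ne', Real.log_mul (Real.exp_pos _).ne' (by positivity),
      Real.log_exp, Real.log_inv, sub_eq_add_neg]
  have hint1 : Integrable (fun x : ∀ i, K i => ∑ i, Real.log (m i (x i))) ν :=
    integrable_finsetSum _ fun i _ => hint i
  have hint2 : Integrable (fun x => t * g x - Real.log W) ν :=
    (htg.sub (IsBddMeas.const _)).integrable ν
  have key := hρ.integral_log_le hq (fun x => mul_nonneg (hMd.nonneg x) (by positivity))
    (le_of_eq (by
      rw [← hMd.integral_dens, ← pi_densMeasure hm, integral_mul_const, ← hξ, ← hWdef,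
        mul_inv_cancel₀ hW.ne']))
    (by
      filter_upwards [hpos] with x hx
      exact mul_pos (Finset.prod_pos fun i _ => hx i) (by positivity))
    ((integrable_congr hlog).2 (hint1.add hint2))
  rw [← hν, integral_congr_ae hlog, integral_add hint1 hint2, integral_finsetSum _ fun i _ => hint i,
    integral_sub (htg.integrable ν) (integrable_const _), integral_const_mul] at key
  simp only [hval, integral_const, probReal_univ, one_smul] at key
  linarith

/-- Restriction of a Gibbs measure to a set on which the discrete gradients differ little: its
product of marginals `ξ` controls both means and relative entropies. -/
theorem exists_product_of_gibbs_restrict {g : (∀ i, K i) → ℝ} (hg : IsBddMeas g) {c : ℝ}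
    (hc : ∀ (x : ∀ i, K i) i y y', g (Function.update x i y) ≤ g (Function.update x i y') + c)
    (star : ∀ i, K i) {A : Set (∀ i, K i)} (hA : MeasurableSet A) {r : ℝ}
    (hr : ∀ x ∈ A, ∀ y ∈ A, ∑ i, (g x - g (Function.update x i (star i)))
      ≤ ∑ i, (g (Function.update y i (x i)) - g (Function.update y i (star i))) + r)
    (hB : 0 < ∫ x in A, Real.exp (g x) ∂(Measure.pi P)) :
    ∃ (ξ : ∀ i, ProbabilityMeasure (K i)) (h : ℝ),
      InformationTheory.klDiv (Measure.pi fun i => (ξ i : Measure (K i))) (Measure.pi P) ≠ ⊤ ∧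
      (InformationTheory.klDiv (Measure.pi fun i => (ξ i : Measure (K i)))
        (Measure.pi P)).toReal = h ∧
      (∀ t, 0 ≤ t →
        t * ((∫ x in A, g x * Real.exp (g x) ∂(Measure.pi P))
              / (∫ x in A, Real.exp (g x) ∂(Measure.pi P))
            - ∫ x, g x ∂(Measure.pi fun i => (ξ i : Measure (K i))))
          - Fintype.card ι * ((t * c) ^ 2 / 8)
        ≤ (∫ x in A, g x * Real.exp (g x) ∂(Measure.pi P))
              / (∫ x in A, Real.exp (g x) ∂(Measure.pi P))
            - Real.log (∫ x in A, Real.exp (g x) ∂(Measure.pi P)) - h) ∧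
      (∫ x in A, (∑ i, (g x - Real.log (coordAvg P i (fun z => Real.exp (g z)) x)))
          * Real.exp (g x) ∂(Measure.pi P)) / (∫ x in A, Real.exp (g x) ∂(Measure.pi P)) - r
        ≤ h := by
  classical
  set B := ∫ x in A, Real.exp (g x) ∂(Measure.pi P) with hBdef
  set ρ : (∀ i, K i) → ℝ := A.indicator fun x => Real.exp (g x) / B with hρdef
  have hρ : IsDensity (Measure.pi P) ρ := by
    refine ⟨⟨(hg.exp.measurable.div_const _).indicator hA, ?_⟩,
      Set.indicator_nonneg fun x _ => by positivity, ?_⟩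
    · obtain ⟨C, hC⟩ := hg.exp.bdd
      refine ⟨C / B, fun x => ?_⟩
      have h0 : |Real.exp (g x) / B| ≤ C / B := by
        rw [abs_div, abs_of_pos hB]
        exact div_le_div_of_nonneg_right (hC x) hB.le
      by_cases hx : x ∈ A
      · simpa [hρdef, hx] using h0
      · simpa [hρdef, hx] using (abs_nonneg _).trans h0
    · rw [integral_indicator hA, integral_div, ← hBdef, div_self hB.ne']
  have := hρ.isProbabilityMeasure
  have hm := fun i => hρ.marginal i
  have := fun i => (hm i).isProbabilityMeasure
  have hkl := klDiv_pi_densMeasure hm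
  set ν := densMeasure (Measure.pi P) ρ with hν
  have hint : ∀ u : (∀ i, K i) → ℝ,
      ∫ x, u x ∂ν = (∫ x in A, u x * Real.exp (g x) ∂(Measure.pi P)) / B := fun u => by
    rw [hρ.integral_dens, ← integral_div, ← integral_indicator hA]
    congr 1
    ext x
    by_cases hx : x ∈ A
    · simp [hρdef, hx]; ring
    · simp [hρdef, hx]
  have hmem : ∀ᵐ x ∂ν, x ∈ A := by
    filter_upwards [hρ.ae_pos] with x hx
    by_contra hxA
    simp [hρdef, hxA] at hx
  have hlogρ : ∫ x, Real.log (ρ x) ∂ν = ∫ x, g x ∂ν - Real.log B := by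
    have : (fun x => Real.log (ρ x)) =ᵐ[ν] fun x => g x - Real.log B := by
      filter_upwards [hmem] with x hx
      rw [hρdef, Set.indicator_of_mem hx, Real.log_div (Real.exp_pos _).ne' hB.ne', Real.log_exp]
    rw [integral_congr_ae this, integral_sub (hg.integrable _) (integrable_const _)]
    simp
  refine ⟨fun i => ⟨densMeasure (P i) (marginalDensity P ρ i), inferInstance⟩, _, hkl.1, hkl.2,
    fun t ht => ?_, ?_⟩
  · have := hρ.mul_integral_sub_le hm hρ.map_eval hg hc ht
    rw [← hν, hlogρ] at this
    rw [← hint g]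
    exact this
  · set h := ∑ i, ∫ y, Real.log (marginalDensity P ρ i y)
      ∂(densMeasure (P i) (marginalDensity P ρ i)) with hh
    obtain ⟨b, hb, hbg⟩ := hg.exp_lower
    have mE : ∀ i, IsBddMeas (fun x => Real.log (coordAvg P i (fun z => Real.exp (g z)) x)) :=
      fun i => (hg.exp.coordAvg i).log hb (le_coordAvg hg.exp i hbg)
    have mS : ∀ i, IsBddMeas (fun x => g (Function.update x i (star i))) := fun i =>
      hg.comp measurable_update_left
    set Λ : (∀ i, K i) → ℝ := fun x => ∑ i, Real.log (coordAvg P i (fun z => Real.exp (g z)) x)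
      with hΛ
    set S : (∀ i, K i) → ℝ := fun x => ∑ i, g (Function.update x i (star i)) with hS
    have mΛ : IsBddMeas Λ := IsBddMeas.sum _ mE
    have mSs : IsBddMeas S := IsBddMeas.sum _ mS
    -- Donsker–Varadhan on each marginal, with `g` frozen at `y` in the other coordinates as test
    -- function; its log-moments add up to `Λ y`.
    have hDV : ∀ y, ∫ x, ∑ i, g (Function.update y i (x i)) ∂ν - Λ y ≤ h := fun y => by
      have mU : ∀ i, IsBddMeas (fun x : ∀ i, K i => g (Function.update y i (x i))) := fun i =>
        (hg.update i y).comp (measurable_pi_apply i)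
      rw [integral_finsetSum _ fun i _ => (mU i).integrable ν, hΛ, ← Finset.sum_sub_distrib]
      refine Finset.sum_le_sum fun i _ => ?_
      have := (hm i).integral_sub_log_integral_exp_le (hg.update i y)
      rw [← hρ.map_eval i, integral_map (measurable_pi_apply i).aemeasurable
        (hg.update i y).measurable.aestronglyMeasurable, hρ.map_eval i] at this
      exact this
    -- A base point in `A` where `Λ - S` does not exceed its `ν`-mean: this trades the value at `y`
    -- for the averages under `ν`, and the terms in `S` then cancel.
    obtain ⟨y, hyA, hy⟩ := exists_notMem_null_le_integral ((mΛ.sub mSs).integrable ν)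
      (show ν Aᶜ = 0 from hmem)
    rw [Set.notMem_compl_iff] at hyA
    have mU : IsBddMeas (fun x : ∀ i, K i => ∑ i, g (Function.update y i (x i))) :=
      IsBddMeas.sum _ fun i => (hg.update i y).comp (measurable_pi_apply i)
    have mN : IsBddMeas (fun x : ∀ i, K i => ∑ _i : ι, g x) := IsBddMeas.sum _ fun i => hg
    have h1 : ∫ x, (∑ _i : ι, g x - S x) ∂ν
        ≤ ∫ x, (∑ i, g (Function.update y i (x i)) + (r - S y)) ∂ν := by
      refine integral_mono_ae ((mN.sub mSs).integrable ν)
        ((mU.add (IsBddMeas.const _)).integrable ν) ?_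
      filter_upwards [hmem] with x hx
      have := hr x hx y hyA
      rw [Finset.sum_sub_distrib, Finset.sum_sub_distrib] at this
      simp only [hS]
      linarith
    rw [integral_add (mU.integrable ν) (integrable_const _),
      integral_sub (mN.integrable ν) (mSs.integrable ν)] at h1
    rw [integral_sub (mΛ.integrable ν) (mSs.integrable ν)] at hy
    have h2 := hDV y
    rw [← hint fun x => ∑ i, (g x - Real.log (coordAvg P i (fun z => Real.exp (g z)) x))]
    simp only [Finset.sum_sub_distrib]
    rw [integral_sub (mN.integrable ν) (mΛ.integrable ν)]
    simp only [integral_const, probReal_univ, one_smul] at h1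
    linarith

end Gibbs

/-! ### Summation over the pieces and optimization in `t`. -/

theorem neg_sum_mul_log_le {N : ℕ} {B : Fin N → ℝ} (hB : ∀ j, 0 ≤ B j) {Z : ℝ} (hZ : 0 < Z)
    (hsum : ∑ j, B j = Z) :
    -∑ j, B j * Real.log (B j) ≤ Z * Real.log N - Z * Real.log Z := by
  have hN : (0 : ℝ) < N := by
    rcases Nat.eq_zero_or_pos N with rfl | h
    · simp at hsum; linarith
    · exact_mod_cast h
  -- The entropy of `B / Z` is compared with the uniform law through `log s ≤ s - 1` at `s = Z / (N
  -- * B j)`.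
  have key : ∀ j, B j * (Real.log Z - Real.log N) - B j * Real.log (B j) ≤ Z / N - B j := by
    intro j
    rcases (hB j).eq_or_lt with h | h
    · rw [← h]; simp; positivity
    · have := Real.log_le_sub_one_of_pos (show 0 < Z / N / B j by positivity)
      rw [Real.log_div (by positivity) h.ne', Real.log_div hZ.ne' hN.ne'] at this
      have := mul_le_mul_of_nonneg_left this h.le
      rw [mul_sub (B j) (_ / _) 1, mul_div_cancel₀ _ h.ne'] at this
      linarith
  have := Finset.sum_le_sum fun j (_ : j ∈ Finset.univ) => key j
  simp only [Finset.sum_sub_distrib, ← Finset.sum_mul, hsum] at this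
  simp only [Finset.sum_const, Finset.card_univ, Fintype.card_fin, nsmul_eq_mul] at this
  rw [mul_div_cancel₀ _ hN.ne'] at this
  linarith

theorem le_two_sqrt_of_forall_le {v D κ : ℝ} (hD : 0 < D) (hκ : 0 ≤ κ)
    (H : ∀ t, 0 < t → v ≤ D / t + κ * t) : v ≤ 2 * Real.sqrt (D * κ) := by
  rcases hκ.eq_or_lt with h | h
  · subst h
    by_contra! hv
    simp only [mul_zero, Real.sqrt_zero] at hv
    -- With `κ = 0` the infimum is approached as `t → ∞`; this `t` already gives `v ≤ v / 2`.
    have := H (2 * D / v) (by positivity)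
    rw [div_div_eq_mul_div, zero_mul, add_zero, mul_comm D v, mul_div_mul_right _ _ hD.ne'] at this
    linarith
  · refine (H (Real.sqrt D / Real.sqrt κ) (by positivity)).trans (le_of_eq ?_)
    have h1 := Real.mul_self_sqrt hD.le
    have h2 := Real.mul_self_sqrt h.le
    have h3 := Real.sqrt_pos.2 hD
    have h4 := Real.sqrt_pos.2 h
    rw [Real.sqrt_mul hD.le]
    set a := Real.sqrt D
    set b := Real.sqrt κ
    rw [← h1, ← h2]
    field_simp
    ring

section

variable {ι : Type*} [Fintype ι] [DecidableEq ι] {K : ι → Type*} [∀ i, MeasurableSpace (K i)]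
  {P : ∀ i, Measure (K i)} [∀ i, IsProbabilityMeasure (P i)]

/-- The form of `exists_product_of_gibbs_restrict` weighted by the mass of the set, which is
meaningful for null sets as well. -/
theorem exists_weighted_bounds {g : (∀ i, K i) → ℝ} (hg : IsBddMeas g) {c : ℝ}
    (hc : ∀ (x : ∀ i, K i) i y y', g (Function.update x i y) ≤ g (Function.update x i y') + c)
    (star : ∀ i, K i) {A : Set (∀ i, K i)} (hA : MeasurableSet A) {r : ℝ}
    (hr : ∀ x ∈ A, ∀ y ∈ A, ∑ i, (g x - g (Function.update x i (star i)))
      ≤ ∑ i, (g (Function.update y i (x i)) - g (Function.update y i (star i))) + r)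
    {C : ℝ} (hC : ∀ ξ : ∀ i, ProbabilityMeasure (K i),
      InformationTheory.klDiv (Measure.pi fun i => (ξ i : Measure (K i))) (Measure.pi P) ≠ ⊤ →
      ∫ x, g x ∂(Measure.pi fun i => (ξ i : Measure (K i)))
        ≤ C + (InformationTheory.klDiv (Measure.pi fun i => (ξ i : Measure (K i)))
          (Measure.pi P)).toReal) :
    ∃ b D : ℝ, b ≤ C * (∫ x in A, Real.exp (g x) ∂(Measure.pi P)) + D ∧
      (∀ t, 0 ≤ t → t * ((∫ x in A, g x * Real.exp (g x) ∂(Measure.pi P)) - b)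
          - (∫ x in A, Real.exp (g x) ∂(Measure.pi P)) * (Fintype.card ι * ((t * c) ^ 2 / 8))
        ≤ (∫ x in A, g x * Real.exp (g x) ∂(Measure.pi P))
            - (∫ x in A, Real.exp (g x) ∂(Measure.pi P))
              * Real.log (∫ x in A, Real.exp (g x) ∂(Measure.pi P)) - D) ∧
      (∫ x in A, (∑ i, (g x - Real.log (coordAvg P i (fun z => Real.exp (g z)) x)))
          * Real.exp (g x) ∂(Measure.pi P)) - r * (∫ x in A, Real.exp (g x) ∂(Measure.pi P))
        ≤ D := by
  have hB0 : 0 ≤ ∫ x in A, Real.exp (g x) ∂(Measure.pi P) :=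
    integral_nonneg fun x => (Real.exp_pos _).le
  rcases hB0.eq_or_lt with hB | hB
  · have hnull : (Measure.pi P).restrict A = 0 := by
      have h0 := (integral_eq_zero_iff_of_nonneg (fun x => (Real.exp_pos (g x)).le)
        (hg.exp.integrable ((Measure.pi P).restrict A))).1 hB.symm
      rw [← Measure.measure_univ_eq_zero]
      refine measure_mono_null (fun x _ => ?_) h0
      exact (Real.exp_pos (g x)).ne'
    refine ⟨0, 0, ?_⟩
    simp [hnull]
  · obtain ⟨ξ, h, hne, hh, h1, h2⟩ := exists_product_of_gibbs_restrict hg hc star hA hr hB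
    have hCξ := hC ξ hne
    rw [hh] at hCξ
    set B := ∫ x in A, Real.exp (g x) ∂(Measure.pi P)
    set F := ∫ x in A, g x * Real.exp (g x) ∂(Measure.pi P)
    set b := ∫ x, g x ∂(Measure.pi fun i => (ξ i : Measure (K i)))
    refine ⟨B * b, B * h, ?_, fun t ht => ?_, ?_⟩
    · have := mul_le_mul_of_nonneg_left hCξ hB.le
      linarith
    · have := mul_le_mul_of_nonneg_left (h1 t ht) hB.le
      have hF : B * (F / B) = F := mul_div_cancel₀ _ hB.ne'
      calc _ = B * (t * (F / B - b) - Fintype.card ι * ((t * c) ^ 2 / 8)) := by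
            rw [mul_sub B, mul_left_comm B t, mul_sub B, hF]
        _ ≤ _ := this
        _ = _ := by rw [mul_sub, mul_sub, hF]
    · have := mul_le_mul_of_nonneg_left h2 hB.le
      rw [mul_sub, mul_div_cancel₀ _ hB.ne'] at this
      linarith

/-- The mean-field bound for the log-partition function of a function whose discrete gradients
vary by at most `r` on each of `N` disjoint sets. -/
theorem log_integral_exp_le_of_partition {g : (∀ i, K i) → ℝ} (hg : IsBddMeas g) {c : ℝ}
    (hc : ∀ (x : ∀ i, K i) i y y', g (Function.update x i y) ≤ g (Function.update x i y') + c)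
    (hc0 : 0 ≤ c) (star : ∀ i, K i) {N : ℕ} {A : Fin N → Set (∀ i, K i)}
    (hA : ∀ j, MeasurableSet (A j)) (hdisj : Pairwise (Function.onFun Disjoint A))
    (hcover : ⋃ j, A j = Set.univ) {r : ℝ}
    (hr : ∀ j, ∀ x ∈ A j, ∀ y ∈ A j, ∑ i, (g x - g (Function.update x i (star i)))
      ≤ ∑ i, (g (Function.update y i (x i)) - g (Function.update y i (star i))) + r)
    {C : ℝ} (hC : ∀ ξ : ∀ i, ProbabilityMeasure (K i),
      InformationTheory.klDiv (Measure.pi fun i => (ξ i : Measure (K i))) (Measure.pi P) ≠ ⊤ →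
      ∫ x, g x ∂(Measure.pi fun i => (ξ i : Measure (K i)))
        ≤ C + (InformationTheory.klDiv (Measure.pi fun i => (ξ i : Measure (K i)))
          (Measure.pi P)).toReal)
    {D : ℝ} (hD : 0 < D) (hND : Real.log N + r ≤ D) :
    Real.log (∫ x, Real.exp (g x) ∂(Measure.pi P))
      ≤ C + Real.log N + Real.sqrt (Fintype.card ι * D / 2) * c := by
  choose b Dj h1 h2 h3 using fun j => exists_weighted_bounds hg hc star (hA j) (hr j) hC
  obtain ⟨a, ha, hag⟩ := hg.exp_lower
  have mG : IsBddMeas (fun x => (∑ i, (g x - Real.log (coordAvg P i (fun z => Real.exp (g z)) x)))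
      * Real.exp (g x)) :=
    (IsBddMeas.sum _ fun i => hg.sub ((hg.exp.coordAvg i).log ha (le_coordAvg hg.exp i hag))).mul
      hg.exp
  have hsum : ∀ u : (∀ i, K i) → ℝ, IsBddMeas u →
      ∑ j, ∫ x in A j, u x ∂(Measure.pi P) = ∫ x, u x ∂(Measure.pi P) := fun u hu => by
    rw [← integral_iUnion_fintype hA hdisj fun j => (hu.integrable _).integrableOn, hcover,
      setIntegral_univ]
  have hZ : 0 < ∫ x, Real.exp (g x) ∂(Measure.pi P) := integral_exp_pos (hg.exp.integrable _)
  have sZ := hsum _ hg.exp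
  have sF := hsum _ (hg.mul hg.exp)
  have sG := hsum _ mG
  have hHan := integral_gibbs_le_sum_coordAvg (P := P) hg
  have hEnt := neg_sum_mul_log_le (fun j => integral_nonneg fun x => (Real.exp_pos _).le) hZ sZ
  have e : ∀ x, (g x - Real.log (∫ z, Real.exp (g z) ∂(Measure.pi P))) * Real.exp (g x)
      = g x * Real.exp (g x)
        - Real.log (∫ z, Real.exp (g z) ∂(Measure.pi P)) * Real.exp (g x) := fun x => by ring
  simp only [e] at hHan
  rw [integral_sub ((hg.mul hg.exp).integrable _) ((hg.exp.integrable _).const_mul _),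
    integral_const_mul] at hHan
  have S1 := Finset.sum_le_sum fun j (_ : j ∈ Finset.univ) => h1 j
  have S2 := fun t ht => Finset.sum_le_sum fun j (_ : j ∈ Finset.univ) => h2 j t ht
  have S3 := Finset.sum_le_sum fun j (_ : j ∈ Finset.univ) => h3 j
  simp only [Finset.sum_add_distrib, Finset.sum_sub_distrib, ← Finset.mul_sum, ← Finset.sum_mul,
    sZ, sF] at S1 S2
  rw [Finset.sum_sub_distrib, ← Finset.mul_sum, sZ, sG] at S3
  generalize (∑ j, (∫ x in A j, Real.exp (g x) ∂(Measure.pi P))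
    * Real.log (∫ x in A j, Real.exp (g x) ∂(Measure.pi P))) = E at S2 hEnt
  generalize ∫ x, (∑ i, (g x - Real.log (coordAvg P i (fun z => Real.exp (g z)) x)))
    * Real.exp (g x) ∂(Measure.pi P) = G at S3 hHan
  generalize ∫ x, g x * Real.exp (g x) ∂(Measure.pi P) = F at S2 hHan
  generalize ∫ x, Real.exp (g x) ∂(Measure.pi P) = Z at *
  generalize ∑ j, b j = b' at *
  generalize ∑ j, Dj j = D' at *
  -- `F - E - D'` is `Z` times the average total correlation.
  have hT0 : 0 ≤ F - E - D' := by
    have := S2 0 le_rfl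
    simpa using this
  -- By `S3` and Han, `D' ≥ F - Z log Z - r Z`; by `hEnt`, `-E ≤ Z log N - Z log Z`.
  have hTD : F - E - D' ≤ Z * D := by
    have := mul_le_mul_of_nonneg_left hND hZ.le
    linarith
  -- `S1` replaces `b'` by `C Z + D'`; then `F - D' ≥ E` from `hT0`, and `hEnt` bounds `E` below by
  -- `Z log Z - Z log N`.
  have main : ∀ t, 0 < t →
      Real.log Z - C - Real.log N ≤ D / t + (Fintype.card ι * (c ^ 2 / 8)) * t := by
    intro t ht
    have h := S2 t ht.le
    have h' : F - b' ≤ (F - E - D') / t + Z * (Fintype.card ι * (c ^ 2 / 8)) * t := by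
      rw [div_add' _ _ _ ht.ne', le_div_iff₀ ht]
      nlinarith
    have h'' : (F - E - D') / t ≤ Z * (D / t) := by
      rw [← mul_div_assoc]
      exact div_le_div_of_nonneg_right hTD ht.le
    refine le_of_mul_le_mul_left ?_ hZ
    linarith
  have := le_two_sqrt_of_forall_le hD (by positivity) main
  have hs : 2 * Real.sqrt (D * (Fintype.card ι * (c ^ 2 / 8)))
      = Real.sqrt (Fintype.card ι * D / 2) * c := by
    rw [show D * (Fintype.card ι * (c ^ 2 / 8)) = (Fintype.card ι * D / 2) * (c / 2) ^ 2 by ring,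
      Real.sqrt_mul (by positivity), Real.sqrt_sq (by positivity)]
    ring
  linarith

end

/-! ### From the covering of gradients to a measurable partition. -/

/-- A set with finite covering number `N` is covered by a sequence of `N` sets of diameter less
than `r`. -/
theorem exists_fin_cover_of_diamCoveringNumber {X : Type*} [PseudoMetricSpace X] {r : ℝ}
    {S : Set X} (h : diamCoveringNumber r S ≠ ⊤) :
    ∃ (N : ℕ) (U : Fin N → Set X), (N : ℕ∞) = diamCoveringNumber r S ∧ S ⊆ ⋃ j, U j ∧
      ∀ j, Metric.ediam (U j) < ENNReal.ofReal r := by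
  obtain ⟨N, hN⟩ := ENat.ne_top_iff_exists.1 h
  have hlt : diamCoveringNumber r S < (N : ℕ∞) + 1 := by
    rw [← hN]
    exact_mod_cast Nat.lt_succ_self N
  rw [diamCoveringNumber] at hlt
  simp only [iInf_lt_iff] at hlt
  obtain ⟨C, ⟨hS, hC⟩, hcard⟩ := hlt
  have hle : C.encard ≤ N := ENat.lt_add_one_iff (ENat.natCast_ne_top N) |>.1 hcard
  have hge : (N : ℕ∞) ≤ C.encard := by
    rw [hN, diamCoveringNumber]
    exact iInf₂_le C ⟨hS, hC⟩
  have hfin : C.Finite := Set.finite_of_encard_le_coe hle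
  have := hfin.fintype
  have hcardC : Fintype.card C = N := by
    have := le_antisymm hle hge
    rw [Set.encard_eq_coe_toFinset_card, Set.toFinset_card] at this
    exact_mod_cast this
  obtain ⟨e⟩ := Fintype.truncEquivFinOfCardEq hcardC
  refine ⟨N, fun j => (e.symm j : Set X), hN, fun x hx => ?_, fun j => hC _ (e.symm j).2⟩
  obtain ⟨s, hs, hxs⟩ := hS hx
  exact Set.mem_iUnion.2 ⟨e ⟨s, hs⟩, by simpa using hxs⟩

/-- The covering sets are arbitrary, so their preimages under the gradient need not be measurable.
Their closures are, and the non-strict bound survives the passage to the closure. -/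
theorem abs_sub_le_of_mem_closure {X : Type*} [TopologicalSpace X] {φ : X → ℝ}
    (hφ : Continuous φ) {s : Set X} {r : ℝ} (h : ∀ a ∈ s, ∀ b ∈ s, |φ a - φ b| ≤ r) {x x' : X}
    (hx : x ∈ closure s) (hx' : x' ∈ closure s) : |φ x - φ x'| ≤ r := by
  have hclosed : IsClosed {p : X × X | |φ p.1 - φ p.2| ≤ r} :=
    isClosed_le (by fun_prop) continuous_const
  have hmem : (x, x') ∈ closure (s ×ˢ s) := by
    rw [closure_prod_eq]
    exact Set.mk_mem_prod hx hx'
  exact closure_minimal (fun p hp => h _ hp.1 _ hp.2) hclosed hmem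

section Gradient

variable {n : ℕ} {K : Fin n → Type*} [∀ i, MetricSpace (K i)] (star : ∀ i, K i)
  (f : (∀ i, K i) →ᵇ ℝ)

theorem discreteGradient_apply (x y : ∀ i, K i) :
    discreteGradient star f x y
      = ∑ i, (f (Function.update x i (y i)) - f (Function.update x i (star i))) := by
  simp [discreteGradient, partialDiff]

theorem continuous_discreteGradient_apply (y : ∀ i, K i) :
    Continuous fun x => discreteGradient star f x y := by
  simp only [discreteGradient_apply]
  exact continuous_finsetSum _ fun i _ =>
    (f.continuous.comp (continuous_id.update i continuous_const)).sub
      (f.continuous.comp (continuous_id.update i continuous_const))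

theorem abs_discreteGradient_sub_le_of_mem_closure {U : Set ((∀ i, K i) →ᵇ ℝ)} {r : ℝ}
    (hU : Metric.ediam U < ENNReal.ofReal r) {x x' : ∀ i, K i}
    (hx : x ∈ closure (discreteGradient star f ⁻¹' U))
    (hx' : x' ∈ closure (discreteGradient star f ⁻¹' U)) (y : ∀ i, K i) :
    |discreteGradient star f x y - discreteGradient star f x' y| ≤ r := by
  refine abs_sub_le_of_mem_closure (continuous_discreteGradient_apply star f y)
    (fun a ha b hb => ?_) hx hx'
  have h1 : edist (discreteGradient star f a) (discreteGradient star f b) < ENNReal.ofReal r :=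
    (Metric.edist_le_ediam_of_mem (Set.mem_preimage.1 ha) (Set.mem_preimage.1 hb)).trans_lt hU
  rw [edist_lt_ofReal] at h1
  have h2 := BoundedContinuousFunction.dist_coe_le_dist (f := discreteGradient star f a)
    (g := discreteGradient star f b) y
  rw [Real.dist_eq] at h2
  exact h2.trans h1.le

end Gradient

end NonlinearLD

/-! ### The main theorem. -/

open NonlinearLD in
theorem proposition5p1 {n : ℕ} {K : Fin n → Type*}
    [∀ i, MetricSpace (K i)] [∀ i, CompleteSpace (K i)]
    [∀ i, TopologicalSpace.SeparableSpace (K i)]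
    [∀ i, MeasurableSpace (K i)] [∀ i, BorelSpace (K i)]
    (hdiam : ∀ i, ∀ x y : K i, dist x y ≤ 1)
    (star : ∀ i, K i)
    (lam : ∀ i, ProbabilityMeasure (K i))
    (f : (∀ i, K i) →ᵇ ℝ) (L ε δ : ℝ) (hL : 0 ≤ L)
    (hf : ∀ x y : ∀ i, K i, |f x - f y| ≤ L * NonlinearLD.avgDist x y)
    (hcov : ((NonlinearLD.diamCoveringNumber (δ * n)
        (Set.range (NonlinearLD.discreteGradient star f)) : ℕ∞) : ENNReal)
          ≤ ENNReal.ofReal (Real.exp (ε * n))) :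
    ((Real.log (∫ x, Real.exp (f x) ∂(Measure.pi fun i => (lam i : Measure (K i)))) : ℝ) : EReal)
      ≤ (⨆ ξ : ∀ i, ProbabilityMeasure (K i),
          NonlinearLD.gibbsFunctional f (Measure.pi fun i => (lam i : Measure (K i)))
            (Measure.pi fun i => (ξ i : Measure (K i))))
        + (((ε + δ) * n + Real.sqrt ((ε + δ) / 2) * L : ℝ) : EReal) := by
  -- Second countability makes the product σ-algebra the Borel one, so that continuous functions on
  -- the product are measurable.
  have hsc : ∀ i, SecondCountableTopology (K i) := fun i =>
    UniformSpace.secondCountable_of_separable (K i)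
  have hfin : diamCoveringNumber (δ * n) (Set.range (discreteGradient star f)) ≠ ⊤ := by
    intro h
    rw [h] at hcov
    simp at hcov
  obtain ⟨N, U, hN, hU, hUd⟩ := exists_fin_cover_of_diamCoveringNumber hfin
  rw [← hN, ENat.toENNReal_coe, ← ENNReal.ofReal_natCast,
    ENNReal.ofReal_le_ofReal_iff (Real.exp_pos _).le] at hcov
  -- The gradient at `star` lies in some covering set, which forces `N ≥ 1`, `δ * n > 0` and `n >
  -- 0`.
  obtain ⟨j₀, -⟩ := Set.mem_iUnion.1 (hU ⟨star, rfl⟩)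
  have hδn : 0 < δ * n := ENNReal.ofReal_pos.1 (pos_of_gt (hUd j₀))
  have hn : (0 : ℝ) < n := by
    rcases Nat.eq_zero_or_pos n with h | h
    · subst h; simp at hδn
    · exact_mod_cast h
  have hN1 : (1 : ℝ) ≤ N := by exact_mod_cast j₀.pos
  have hlogN : Real.log N ≤ ε * n := (Real.log_le_iff_le_exp (by linarith)).2 hcov
  have hlogN0 : 0 ≤ Real.log N := Real.log_nonneg hN1
  have hg : IsBddMeas (f : (∀ i, K i) → ℝ) :=
    ⟨f.continuous.measurable, ‖f‖, fun x => f.norm_coe_le_norm x⟩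
  have hosc : ∀ (x : ∀ i, K i) i y y',
      f (Function.update x i y) ≤ f (Function.update x i y') + L / n := by
    intro x i y y'
    have h1 := (le_abs_self _).trans (hf (Function.update x i y) (Function.update x i y'))
    have h2 : avgDist (Function.update x i y) (Function.update x i y') ≤ 1 / n := by
      rw [avgDist, Finset.sum_eq_single i (fun j _ hj => by simp [hj]) (by simp)]
      simp only [Function.update_self]
      exact mul_le_of_le_one_right (by positivity) (hdiam i y y')
    have h3 := mul_le_mul_of_nonneg_left h2 hL
    rw [mul_one_div] at h3
    linarith
  set V : Fin N → Set (∀ i, K i) := fun j => closure (discreteGradient star f ⁻¹' U j) with hV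
  have hr : ∀ j, ∀ x ∈ disjointed V j, ∀ y ∈ disjointed V j,
      ∑ i, (f x - f (Function.update x i (star i)))
      ≤ ∑ i, (f (Function.update y i (x i)) - f (Function.update y i (star i))) + δ * n := by
    intro j x hx y hy
    have := (le_abs_self _).trans (abs_discreteGradient_sub_le_of_mem_closure star f (hUd j)
      (disjointed_le V j hx) (disjointed_le V j hy) x)
    simp only [discreteGradient_apply, Function.update_eq_self] at this
    linarith
  have hcover : ⋃ j, disjointed V j = Set.univ := by
    rw [iUnion_disjointed]
    refine Set.eq_univ_of_forall fun x => ?_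
    obtain ⟨j, hj⟩ := Set.mem_iUnion.1 (hU ⟨x, rfl⟩)
    exact Set.mem_iUnion.2 ⟨j, subset_closure hj⟩
  -- Stated for a real upper bound `C`, since the supremum lives in `EReal`; the value `⊥` is later
  -- excluded by taking `ξ = lam`.
  have hreal : ∀ C : ℝ, (⨆ ξ : ∀ i, ProbabilityMeasure (K i),
      gibbsFunctional f (Measure.pi fun i => (lam i : Measure (K i)))
        (Measure.pi fun i => (ξ i : Measure (K i)))) ≤ (C : EReal) →
      Real.log (∫ x, Real.exp (f x) ∂(Measure.pi fun i => (lam i : Measure (K i))))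
        ≤ C + ((ε + δ) * n + Real.sqrt ((ε + δ) / 2) * L) := by
    intro C hC
    have hbound := log_integral_exp_le_of_partition (P := fun i => (lam i : Measure (K i))) hg hosc
      (by positivity) star (A := disjointed V)
      (fun j => disjointedRec (fun _ _ ht => ht.diff isClosed_closure.measurableSet)
        isClosed_closure.measurableSet)
      (disjoint_disjointed V) hcover hr (C := C) (fun ξ hξ => ?_) (D := (ε + δ) * n)
      (by linarith) (by linarith)
    -- With `c = L / n` the powers of `n` cancel in the square-root term. The additive term is only
    -- `log N ≤ ε * n`; the summand `δ * n > 0` is slack.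
    · rw [Fintype.card_fin, show n * ((ε + δ) * n) / 2 = (ε + δ) / 2 * (n : ℝ) ^ 2 by ring,
        Real.sqrt_mul' _ (by positivity), Real.sqrt_sq hn.le, mul_assoc,
        mul_div_cancel₀ _ hn.ne'] at hbound
      linarith
    · have h := (le_iSup _ ξ).trans hC
      rw [gibbsFunctional, ← EReal.coe_ennreal_toReal hξ, ← EReal.coe_sub, EReal.coe_le_coe_iff] at h
      linarith
  set S := ⨆ ξ : ∀ i, ProbabilityMeasure (K i),
      gibbsFunctional f (Measure.pi fun i => (lam i : Measure (K i)))
        (Measure.pi fun i => (ξ i : Measure (K i))) with hS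
  have hSbot : S ≠ ⊥ := by
    refine ne_bot_of_le_ne_bot ?_ (le_iSup _ lam)
    rw [gibbsFunctional, InformationTheory.klDiv_self]
    simp
  induction hS' : S with
  | bot => exact absurd hS' hSbot
  | top => rw [EReal.top_add_coe]; exact le_top
  | coe C =>
    rw [← EReal.coe_add, EReal.coe_le_coe_iff]
    exact hreal C hS'.le
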